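/- Fix a field $k$ of characteristic zero. Let $\mathcal{G}$ be the category whose objects are finite groups and whose morphisms are conjugacy classes of surjective group homomorphisms, and let $\mathcal{U}\subseteq\mathcal{G}$ be a replete full subcategory. Write $\pi_0(\mathcal{U})$ for its set of isomorphism classes, $\mathrm{A}(\mathcal{U})=\mathrm{Fun}(\mathcal{U}^{\mathrm{op}},\mathrm{Mod}\,k)$ with the pointwise tensor product, with unit the constant functor $\mathbf 1$ with value $k$, and $e_G=k[\mathrm{Hom}_{\mathcal{U}}(-,G)]$ for $G\in\mathcal{U}$. An object of $\mathrm{A}(\mathcal{U})$ is finitely generated if it is a quotient of a finite direct sum $\bigoplus_{i=1}^n e_{G_i}$, and $\mathrm{A}(\mathcal{U})^c$ is the full subcategory of finitely generated objects. The support of $X$ is $\mathrm{supp}(X)=\{[G]\in\pi_0(\mathcal{U}) : X(G)\neq 0\}$. Assume that 1. $\mathcal{U}$ is widely closed (whenever $G\twoheadleftarrow H\twoheadrightarrow K$ are surjective homomorphisms with $G,H,K\in\mathcal{U}$, the image of $H\to G\times K$ is in $\mathcal{U}$) and $\mathbf 1$ is finitely generated; 2. $\mathcal{U}$ is noetherian: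 every subobject of $e_G$ is finitely generated, for every $G\in\mathcal{U}$ (so that $\mathrm{A}(\mathcal{U})^c$ is a tensor abelian category); 3. $\mathcal{U}$ is $\mathbb{N}$-stable: there are $G_n\in\mathcal{U}$ $(n\in\mathbb{N})$ such that $n\mapsto[G_n]$ is a bijection $\mathbb{N}\to\pi_0(\mathcal{U})$; for $m\ne n$ an epimorphism exists in exactly one of the directions $G_m\twoheadrightarrow G_n$, $G_n\twoheadrightarrow G_m$; for $m\le n$ there is an epimorphism $G_n\twoheadrightarrow G_m$; and for every finitely generated $X\in\mathrm{A}(\mathcal{U})$ there is $r\in\mathbb{N}$ such that $\alpha^*:X(G_n)\to X(G_m)$ is injective for every epimorphism $\alpha:G_m\twoheadrightarrow G_n$ with $n>r$. A Serre ideal of $\mathrm{A}(\mathcal{U})^c$ is a full subcategory that contains $0$, is closed under subobjects, quotients and extensions, and is closed under tensoring with arbitrary objects of $\mathrm{A}(\mathcal{U})^c$. A proper Serre ideal $P$ is prime if $X\otimes Y\in P$ implies $X\in P$ or $Y\in P$. The set $\mathrm{Spc}(\mathrm{A}(\mathcal{U})^c)$ of prime Serre ideals carries the topology whose closed sets are the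 sets $Z(S)=\{P : P\cap S=\varnothing\}$, for families $S$ of objects of $\mathrm{A}(\mathcal{U})^c$. **Theorem.** The prime Serre ideals of $\mathrm{A}(\mathcal{U})^c$ are exactly the group primes $P_n=\{X\in\mathrm{A}(\mathcal{U})^c : X(G_n)=0\}$ $(n\in\mathbb{N})$ and $P_\infty=\{X\in\mathrm{A}(\mathcal{U})^c : \mathrm{supp}(X)\text{ is finite}\}$. Moreover $\mathrm{Spc}(\mathrm{A}(\mathcal{U})^c)$ is homeomorphic to the one-point compactification $\mathbb{N}^*=\mathbb{N}\cup\{\infty\}$ of the discrete space $\mathbb{N}$; indeed there is a homeomorphism $\mathbb{N}^*\to\mathrm{Spc}(\mathrm{A}(\mathcal{U})^c)$ with $n\mapsto P_n$ and $\infty\mapsto P_\infty$. -/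

import Mathlib

open CategoryTheory Limits Opposite MonoidalCategory

universe u v w

noncomputable section

/-! ### Tensor abelian geometry -/

section Spectrum

variable {C : Type w} [Category.{v} C] [Abelian C] [MonoidalCategory C]

/-- A Serre ideal: a Serre subcategory `D` (containing `0`, closed under subobjects, quotients and
extensions) such that `X ⊗ Y ∈ D` for all `X ∈ D` and all objects `Y`. -/
structure IsSerreIdeal (D : ObjectProperty C) : Prop where
  isSerreClass : D.IsSerreClass
  tensor_mem : ∀ X Y : C, D X → D (X ⊗ Y)

/-- A prime Serre ideal: a proper Serre ideal `P` such that `X ⊗ Y ∈ P` implies `X ∈ P` or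
`Y ∈ P`. -/
structure IsPrimeSerreIdeal (P : ObjectProperty C) : Prop extends IsSerreIdeal P where
  ne_top : P ≠ ⊤
  mem_or_mem : ∀ X Y : C, P (X ⊗ Y) → P X ∨ P Y

variable (C) in
/-- The set of all prime Serre ideals of `C`. -/
structure Spc where
  /-- the objects of the prime Serre ideal -/
  carrier : ObjectProperty C
  isPrime : IsPrimeSerreIdeal carrier

/-- `Z(S)`: the primes `P` with `P ∩ S = ∅`. -/
def Spc.zeroLocus (S : Set C) : Set (Spc C) :=
  {P | ∀ X ∈ S, ¬ P.carrier X}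

lemma IsSerreIdeal.biprod_iff {D : ObjectProperty C} (hD : IsSerreIdeal D) (X Y : C) :
    D (X ⊞ Y) ↔ D X ∧ D Y := by
  have := hD.isSerreClass
  exact D.prop_iff_of_shortExact (ShortComplex.Splitting.ofHasBinaryBiproduct X Y).shortExact

/-- The Zariski topology: the closed sets are exactly the `Z(S)`. -/
instance : TopologicalSpace (Spc C) :=
  TopologicalSpace.ofClosed {T | ∃ S : Set C, T = Spc.zeroLocus S}
    (by
      refine ⟨Set.univ, ?_⟩
      ext P
      simp only [Set.mem_empty_iff_false, false_iff]
      intro h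
      have := P.isPrime.isSerreClass
      obtain ⟨Z, _, hZ⟩ := P.carrier.exists_prop_of_containsZero
      exact h Z trivial hZ)
    (by
      intro A hA
      refine ⟨{X | ∃ S : Set C, Spc.zeroLocus S ∈ A ∧ X ∈ S}, ?_⟩
      ext P
      constructor
      · rintro h X ⟨S, hS, hX⟩
        exact h _ hS X hX
      · intro h T hT
        obtain ⟨S, rfl⟩ := hA hT
        exact fun X hX => h X ⟨S, hT, hX⟩)
    (by
      rintro _ ⟨S, rfl⟩ _ ⟨T, rfl⟩
      refine ⟨{Z | ∃ X ∈ S, ∃ Y ∈ T, Z = (X ⊞ Y : C)}, ?_⟩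
      ext P
      constructor
      · rintro (h | h) _ ⟨X, hX, Y, hY, rfl⟩ hP
        · exact h X hX ((P.isPrime.biprod_iff X Y).1 hP).1
        · exact h Y hY ((P.isPrime.biprod_iff X Y).1 hP).2
      · intro h
        by_contra hc
        simp only [Set.mem_union, not_or] at hc
        obtain ⟨h₁, h₂⟩ := hc
        simp only [Spc.zeroLocus, Set.mem_ofPred_eq, not_forall, not_not] at h₁ h₂
        obtain ⟨X, hX, hPX⟩ := h₁
        obtain ⟨Y, hY, hPY⟩ := h₂
        exact h _ ⟨X, hX, Y, hY, rfl⟩ ((P.isPrime.biprod_iff X Y).2 ⟨hPX, hPY⟩))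

end Spectrum

section Subobjects

variable {C : Type w} [Category.{v} C] [Abelian C] (P : ObjectProperty C)

lemma prop_of_mono_of_exact [P.IsClosedUnderExtensions] {A X B Y : C} (f : A ⟶ X) (g : X ⟶ B)
    (w : f ≫ g = 0) (hfg : (ShortComplex.mk f g w).Exact) [Mono f]
    (hA : ∀ (Z : C) (i : Z ⟶ A), Mono i → P Z)
    (hB : ∀ (Z : C) (i : Z ⟶ B), Mono i → P Z) (i : Y ⟶ X) [Mono i] : P Y := by
  have hS : (ShortComplex.mk (kernel.ι (i ≫ g)) (Abelian.factorThruImage (i ≫ g))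
      (by
        rw [← cancel_mono (Abelian.image.ι (i ≫ g)), Category.assoc, Abelian.image.fac,
          kernel.condition, zero_comp])).ShortExact :=
    { exact := by
        refine ShortComplex.exact_of_f_is_kernel _ (KernelFork.IsLimit.ofι _ _
          (fun {Z} t ht => kernel.lift _ t ?_) (fun t ht => kernel.lift_ι _ _ _) ?_)
        · rw [← Abelian.image.fac (i ≫ g), ← Category.assoc]
          dsimp only at ht
          rw [ht, zero_comp]
        · intro Z t ht m hm
          rw [← cancel_mono (kernel.ι (i ≫ g)), kernel.lift_ι]
          exact hm }
  refine P.prop_X₂_of_shortExact hS ?_ ?_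
  · refine hA _ (hfg.lift (kernel.ι (i ≫ g) ≫ i) (by simp)) ?_
    have e : hfg.lift (kernel.ι (i ≫ g) ≫ i) (by simp) ≫ f = kernel.ι (i ≫ g) ≫ i :=
      hfg.lift_f _ _
    have : Mono (hfg.lift (kernel.ι (i ≫ g) ≫ i) (by simp) ≫ f) := by
      rw [e]
      infer_instance
    exact mono_of_mono _ f
  · exact hB _ (Abelian.image.ι (i ≫ g)) inferInstance

lemma prop_of_mono_of_cokernel [P.IsClosedUnderExtensions] [P.IsClosedUnderQuotients]
    {E X Y : C} (d : E ⟶ X) (hE : ∀ (Z : C) (i : Z ⟶ E), Mono i → P Z)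
    (hB : ∀ (Z : C) (i : Z ⟶ cokernel d), Mono i → P Z) (i : Y ⟶ X) [Mono i] : P Y :=
  prop_of_mono_of_exact P (Abelian.image.ι d) (cokernel.π d) (kernel.condition _)
    (ShortComplex.exact_of_f_is_kernel _ (kernelIsKernel _))
    (fun _ j _ => P.prop_of_epi (pullback.fst j (Abelian.factorThruImage d))
      (hE _ (pullback.snd j (Abelian.factorThruImage d)) inferInstance)) hB i

lemma isClosedUnderFiniteProducts_of_extensions [P.ContainsZero] [P.IsClosedUnderQuotients]
    [P.IsClosedUnderExtensions] : P.IsClosedUnderFiniteProducts := by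
  have : P.IsClosedUnderBinaryProducts :=
    { limitsOfShape_le := by
        rintro X ⟨p⟩
        have h := P.prop_biprod (p.prop_diag_obj ⟨.left⟩) (p.prop_diag_obj ⟨.right⟩)
        have e : X ≅ p.diag.obj ⟨.left⟩ ⊞ p.diag.obj ⟨.right⟩ :=
          (p.isLimit.conePointsIsoOfNatIso (BinaryBiproduct.isLimit _ _) (diagramIsoPair _))
        exact P.prop_of_iso e.symm h }
  exact .mk'

end Subobjects

/-! ### Finite groups and conjugacy classes of surjective homomorphisms -/

/-- Objects of the category `𝒢`: finite groups. -/
structure FinGrpOut : Type (u + 1) where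
  /-- the underlying type of the group -/
  carrier : Type u
  [group : Group carrier]
  [finite : Finite carrier]

namespace FinGrpOut

instance : CoeSort FinGrpOut.{u} (Type u) := ⟨FinGrpOut.carrier⟩

instance (G : FinGrpOut.{u}) : Group G := G.group

instance (G : FinGrpOut.{u}) : Finite G := G.finite

/-- Two surjective homomorphisms `G → H` are equivalent if they are conjugate by an element
of `H`. -/
def conjSetoid (G H : FinGrpOut.{u}) : Setoid {f : G →* H // Function.Surjective f} where
  r f g := ∃ h : H, ∀ x, g.1 x = h * f.1 x * h⁻¹
  iseqv :=
    { refl := fun f => ⟨1, by simp⟩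
      symm := by
        rintro f g ⟨h, hh⟩
        exact ⟨h⁻¹, fun x => by rw [hh x]; group⟩
      trans := by
        rintro f g e ⟨h, hh⟩ ⟨h', hh'⟩
        exact ⟨h' * h, fun x => by rw [hh' x, hh x]; group⟩ }

/-- Morphisms of `𝒢` are conjugacy classes of surjective homomorphisms. -/
instance : Category.{u} FinGrpOut.{u} where
  Hom G H := Quotient (conjSetoid G H)
  id G := Quotient.mk _ ⟨MonoidHom.id G, Function.surjective_id⟩
  comp {G H K} a b := Quotient.map₂
    (fun f g => ⟨g.1.comp f.1, g.2.comp f.2⟩ :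
      {f : G →* H // Function.Surjective f} → {g : H →* K // Function.Surjective g} →
        {f : G →* K // Function.Surjective f})
    (by
      rintro f f' ⟨h, hh⟩ g g' ⟨h', hh'⟩
      refine ⟨h' * g.1 h, fun x => ?_⟩
      simp only [MonoidHom.comp_apply, hh, hh', map_mul, map_inv]
      group) a b
  id_comp := by rintro G H ⟨f⟩; rfl
  comp_id := by rintro G H ⟨f⟩; rfl
  assoc := by rintro G H K L ⟨f⟩ ⟨g⟩ ⟨h⟩; rfl

/-- The morphism of `𝒢` represented by a surjective homomorphism. -/
def homMk {G H : FinGrpOut.{u}} (f : G →* H) (hf : Function.Surjective f) : G ⟶ H :=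
  Quotient.mk (conjSetoid G H) ⟨f, hf⟩

lemma homMk_comp {G H K : FinGrpOut.{u}} (f : G →* H) (hf : Function.Surjective f)
    (g : H →* K) (hg : Function.Surjective g) :
    homMk f hf ≫ homMk g hg = homMk (g.comp f) (hg.comp hf) := rfl

lemma exists_homMk {G H : FinGrpOut.{u}} (a : G ⟶ H) : ∃ f hf, a = homMk f hf := by
  induction a using Quotient.inductionOn with
  | h f => exact ⟨f.1, f.2, rfl⟩

end FinGrpOut

/-- `𝒰` is widely closed: if `G ↞ H ↠ K` are surjections between groups in `𝒰`, then the image of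
`H → G × K` is in `𝒰`. -/
class IsWidelyClosed (U : ObjectProperty FinGrpOut.{u}) : Prop where
  range_mem : ∀ (G H K : FinGrpOut.{u}) (f : H →* G) (g : H →* K),
    Function.Surjective f → Function.Surjective g → U G → U H → U K → U ⟨(f.prod g).range⟩

section Wide

variable {U : ObjectProperty FinGrpOut.{u}}

/-- The subgroups of `G × K` that belong to `𝒰` and project onto both factors. -/
structure WideSubgroup (G K : U.FullSubcategory) where
  /-- the subgroup -/
  subgroup : Subgroup (G.obj × K.obj)
  mem : U ⟨subgroup⟩
  fst_surjective : Function.Surjective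
    ((MonoidHom.fst G.obj K.obj).comp (Subgroup.subtype subgroup))
  snd_surjective : Function.Surjective
    ((MonoidHom.snd G.obj K.obj).comp (Subgroup.subtype subgroup))

namespace WideSubgroup

variable {G K H : U.FullSubcategory}

instance : Finite (WideSubgroup G K) :=
  Finite.of_injective WideSubgroup.subgroup (by rintro ⟨⟩ ⟨⟩ h; cases h; rfl)

/-- A wide subgroup as an object of `𝒰`. -/
def grp (S : WideSubgroup G K) : U.FullSubcategory := ⟨⟨S.subgroup⟩, S.mem⟩

/-- The first projection. -/
def fst (S : WideSubgroup G K) : S.grp ⟶ G :=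
  ObjectProperty.homMk (FinGrpOut.homMk (G := S.grp.obj) _ S.fst_surjective)

/-- The second projection. -/
def snd (S : WideSubgroup G K) : S.grp ⟶ K :=
  ObjectProperty.homMk (FinGrpOut.homMk (G := S.grp.obj) _ S.snd_surjective)

lemma exists_lift [IsWidelyClosed U] (φ : H ⟶ G) (ψ : H ⟶ K) :
    ∃ (S : WideSubgroup G K) (θ : H ⟶ S.grp), φ = θ ≫ S.fst ∧ ψ = θ ≫ S.snd := by
  obtain ⟨f, hf, hφ⟩ := FinGrpOut.exists_homMk φ.hom
  obtain ⟨g, hg, hψ⟩ := FinGrpOut.exists_homMk ψ.hom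
  refine ⟨⟨(f.prod g).range, IsWidelyClosed.range_mem _ _ _ f g hf hg
    G.property H.property K.property, ?_, ?_⟩, ObjectProperty.homMk
      (FinGrpOut.homMk (f.prod g).rangeRestrict (f.prod g).rangeRestrict_surjective), ?_, ?_⟩
  · intro a
    obtain ⟨h, rfl⟩ := hf a
    exact ⟨⟨_, h, rfl⟩, rfl⟩
  · intro a
    obtain ⟨h, rfl⟩ := hg a
    exact ⟨⟨_, h, rfl⟩, rfl⟩
  · ext
    exact hφ
  · ext
    exact hψ

end WideSubgroup

end Wide

/-! ### Global representations -/

section GlobalRep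

variable (k : Type u) [Field k] (U : ObjectProperty FinGrpOut.{u})

/-- `A(𝒰)`: contravariant functors from `𝒰` to `k`-vector spaces. -/
abbrev GlobalRep := U.FullSubcategoryᵒᵖ ⥤ ModuleCat.{u} k

instance : Abelian (GlobalRep k U) := inferInstance

instance : HasFiniteBiproducts (GlobalRep k U) := Abelian.hasFiniteBiproducts

variable {U} in
/-- `e_G = k[Hom_𝒰(-, G)]`. -/
def eObj (G : U.FullSubcategory) : GlobalRep k U := yoneda.obj G ⋙ ModuleCat.free k

/-- Finitely generated objects: quotients of finite sums `e_{G_1} ⊕ ⋯ ⊕ e_{G_n}`. -/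
def finGen : ObjectProperty (GlobalRep k U) := fun X =>
  ∃ (n : ℕ) (G : Fin n → U.FullSubcategory) (f : (⨁ fun i => eObj k (G i)) ⟶ X), Epi f

/-- `𝒰` is noetherian (over `k`): every subobject of every `e_G` is finitely generated. -/
class IsNoetherianFamily : Prop where
  finGen_of_mono : ∀ (G : U.FullSubcategory) (Y : GlobalRep k U) (i : Y ⟶ eObj k G),
    Mono i → finGen k U Y

variable {k U}

/-- The map `e_G ⟶ X` classified by `x ∈ X(G)`. -/
def eDesc {X : GlobalRep k U} {G : U.FullSubcategory} (x : X.obj (op G)) : eObj k G ⟶ X where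
  app H := ModuleCat.freeDesc (X := (yoneda.obj G).obj H) (↾fun φ => X.map φ.op x)
  naturality H K φ := by
    refine ModuleCat.free_hom_ext fun ψ => ?_
    simp [eObj]

lemma eDesc_app {X : GlobalRep k U} {G : U.FullSubcategory} (x : X.obj (op G))
    (H : U.FullSubcategory) (φ : H ⟶ G) :
    (eDesc x).app (op H) (ModuleCat.freeMk (X := (yoneda.obj G).obj (op H)) φ)
      = X.map φ.op x := by
  exact ModuleCat.freeDesc_apply _ _

/-- A finite family of elements generates `X`. -/
def Generates {ι : Type*} {X : GlobalRep k U} (G : ι → U.FullSubcategory)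
    (x : ∀ i, X.obj (op (G i))) : Prop :=
  ∀ H : U.FullSubcategory, Submodule.span k
    {y : X.obj (op H) | ∃ (i : ι) (φ : H ⟶ G i), y = X.map φ.op (x i)} = ⊤

lemma surjective_app_of_epi {X Y : GlobalRep k U} (f : X ⟶ Y) [Epi f]
    (H : U.FullSubcategoryᵒᵖ) : Function.Surjective (f.app H) :=
  (ModuleCat.epi_iff_surjective _).1 inferInstance

lemma epi_of_surjective_app {X Y : GlobalRep k U} (f : X ⟶ Y)
    (h : ∀ H, Function.Surjective (f.app H)) : Epi f := by
  have : ∀ H, Epi (f.app H) := fun H => (ModuleCat.epi_iff_surjective _).2 (h H)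
  exact NatTrans.epi_of_epi_app f

lemma finGen_of_generates {ι : Type*} [Finite ι] {X : GlobalRep k U} {G : ι → U.FullSubcategory}
    {x : ∀ i, X.obj (op (G i))} (h : Generates G x) : finGen k U X := by
  obtain ⟨n, ⟨e⟩⟩ := Finite.exists_equiv_fin ι
  refine ⟨n, fun i => G (e.symm i), biproduct.desc fun i => eDesc (x (e.symm i)), ?_⟩
  refine epi_of_surjective_app _ fun ⟨H⟩ => ?_
  have key : (⊤ : Submodule k (X.obj (op H))) ≤ LinearMap.range
      ((biproduct.desc fun i => eDesc (x (e.symm i))).app (op H)).hom := by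
    rw [← h H, Submodule.span_le]
    rintro y ⟨i, φ, rfl⟩
    obtain ⟨j, rfl⟩ := e.symm.surjective i
    refine ⟨(biproduct.ι (fun i => eObj k (G (e.symm i))) j).app (op H)
      (ModuleCat.freeMk (X := (yoneda.obj (G (e.symm j))).obj (op H)) φ), ?_⟩
    rw [← eDesc_app (x (e.symm j)) H φ]
    have := biproduct.ι_desc (fun i => eDesc (x (e.symm i))) j
    rw [← this]
    rfl
  intro y
  exact key (Submodule.mem_top : y ∈ ⊤)

lemma span_eObj (G H : U.FullSubcategory) :
    (Submodule.span k (Set.range fun φ : H ⟶ G =>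
      (ModuleCat.freeMk (X := (yoneda.obj G).obj (op H)) φ : (eObj k G).obj (op H)))) = ⊤ :=
  (Finsupp.basisSingleOne (R := k) (ι := H ⟶ G)).span_eq

lemma exists_generates {X : GlobalRep k U} (hX : finGen k U X) :
    ∃ (n : ℕ) (G : Fin n → U.FullSubcategory) (x : ∀ i, X.obj (op (G i))), Generates G x := by
  obtain ⟨n, G, f, hf⟩ := hX
  let g : ∀ i, eObj k (G i) ⟶ X := fun i => biproduct.ι (fun i => eObj k (G i)) i ≫ f
  refine ⟨n, G, fun i => (g i).app (op (G i))
    (ModuleCat.freeMk (X := (yoneda.obj (G i)).obj (op (G i))) (𝟙 (G i))), fun H => ?_⟩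
  set W := Submodule.span k {y : X.obj (op H) | ∃ (i : Fin n) (φ : H ⟶ G i),
    y = X.map φ.op ((g i).app (op (G i))
      (ModuleCat.freeMk (X := (yoneda.obj (G i)).obj (op (G i))) (𝟙 (G i))))} with hW
  have hg : ∀ (i : Fin n) (z : (eObj k (G i)).obj (op H)), (g i).app (op H) z ∈ W := by
    intro i z
    have hz : (⊤ : Submodule k ((eObj k (G i)).obj (op H))) ≤
        W.comap ((g i).app (op H)).hom := by
      refine (span_eObj (G i) H).symm.le.trans ?_
      refine Submodule.span_le.2 ?_
      rintro _ ⟨φ, rfl⟩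
      refine Submodule.subset_span ⟨i, φ, ?_⟩
      refine Eq.trans ?_ (NatTrans.naturality_apply (g i) φ.op _)
      refine congrArg ((g i).app (op H)) ?_
      refine Eq.trans ?_ (ModuleCat.free_map_apply _ _).symm
      exact congrArg _ (Category.comp_id φ).symm
    exact hz (Submodule.mem_top : z ∈ ⊤)
  rw [eq_top_iff]
  rintro y -
  obtain ⟨z, rfl⟩ := surjective_app_of_epi f (op H) y
  have hsum : f = ∑ i, biproduct.π (fun i => eObj k (G i)) i ≫ g i := by
    have h := congrArg (· ≫ f) (biproduct.total (f := fun i => eObj k (G i)))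
    rw [Preadditive.sum_comp, Category.id_comp] at h
    rw [← h]
    exact Finset.sum_congr rfl fun i _ => Category.assoc _ _ _
  rw [hsum, NatTrans.app_sum]
  simp only [ModuleCat.hom_sum, LinearMap.sum_apply]
  exact W.sum_mem fun i _ => hg i _

lemma finGen_of_epi {X Y : GlobalRep k U} (f : X ⟶ Y) [Epi f] (hX : finGen k U X) :
    finGen k U Y := by
  obtain ⟨n, G, g, hg⟩ := hX
  exact ⟨n, G, g ≫ f, inferInstance⟩

lemma finGen_of_isZero {X : GlobalRep k U} (hX : IsZero X) : finGen k U X :=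
  ⟨0, Fin.elim0, 0, ⟨fun _ _ _ => hX.eq_of_src _ _⟩⟩

instance : (finGen k U).IsClosedUnderQuotients where
  prop_of_epi f _ h := finGen_of_epi f h

instance : (finGen k U).ContainsZero where
  exists_zero := ⟨_, isZero_zero _, finGen_of_isZero (isZero_zero _)⟩

instance : (finGen k U).IsClosedUnderExtensions where
  prop_X₂_of_shortExact {S} hS h₁ h₃ := by
    have := hS.mono_f
    have := hS.epi_g
    obtain ⟨n, G, x, hx⟩ := exists_generates h₁
    obtain ⟨m, K, y, hy⟩ := exists_generates h₃
    choose z hz using fun j => surjective_app_of_epi S.g (op (K j)) (y j)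
    refine finGen_of_generates (ι := Fin n ⊕ Fin m) (G := Sum.elim G K)
      (x := fun i => Sum.rec (motive := fun i => S.X₂.obj (op (Sum.elim G K i)))
        (fun i => S.f.app _ (x i)) (fun j => z j) i) fun H => ?_
    set W := Submodule.span k {w : S.X₂.obj (op H) | ∃ (i : Fin n ⊕ Fin m)
      (φ : H ⟶ Sum.elim G K i), w = S.X₂.map φ.op
        (Sum.rec (motive := fun i => S.X₂.obj (op (Sum.elim G K i)))
        (fun i => S.f.app _ (x i)) (fun j => z j) i)} with hW
    have hf : ∀ a, S.f.app (op H) a ∈ W := by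
      intro a
      have ha : (⊤ : Submodule k _) ≤ W.comap (S.f.app (op H)).hom := by
        rw [← hx H, Submodule.span_le]
        rintro _ ⟨i, φ, rfl⟩
        refine Submodule.subset_span ⟨Sum.inl i, φ, ?_⟩
        exact NatTrans.naturality_apply S.f φ.op (x i)
      exact ha (Submodule.mem_top : a ∈ ⊤)
    have hg : ∀ b, ∃ w ∈ W, S.g.app (op H) w = b := by
      intro b
      have hb : (⊤ : Submodule k _) ≤ W.map (S.g.app (op H)).hom := by
        rw [← hy H, Submodule.span_le]
        rintro _ ⟨j, φ, rfl⟩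
        refine ⟨S.X₂.map φ.op (z j), Submodule.subset_span ⟨Sum.inr j, φ, rfl⟩, ?_⟩
        refine (NatTrans.naturality_apply S.g φ.op (z j)).trans ?_
        rw [hz]
      exact hb (Submodule.mem_top : b ∈ ⊤)
    rw [eq_top_iff]
    rintro w -
    obtain ⟨w', hw', hww⟩ := hg (S.g.app (op H) w)
    have hex : (S.map ((evaluation _ _).obj (op H))).ShortExact :=
      hS.map_of_exact ((evaluation _ _).obj (op H))
    obtain ⟨a, ha⟩ := (ShortComplex.moduleCat_exact_iff _).1 hex.exact (w - w')
      (by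
        change (S.g.app (op H)).hom (w - w') = 0
        rw [map_sub, sub_eq_zero]
        exact hww.symm)
    have : w = S.f.app (op H) a + w' := by
      change (S.f.app (op H)) a = w - w' at ha
      rw [ha, sub_add_cancel]
    rw [this]
    exact W.add_mem (hf a) hw'

/-- The pure tensor `x ⊗ y ∈ (X ⊗ Y)(H) = X(H) ⊗ Y(H)`. -/
def tmul {X Y : GlobalRep k U} {H : U.FullSubcategory} (x : X.obj (op H)) (y : Y.obj (op H)) :
    (X ⊗ Y).obj (op H) :=
  TensorProduct.tmul k x y

lemma map_tmul {X Y : GlobalRep k U} {H K : U.FullSubcategory} (θ : H ⟶ K)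
    (x : X.obj (op K)) (y : Y.obj (op K)) :
    (X ⊗ Y).map θ.op (tmul x y) = tmul (X.map θ.op x) (Y.map θ.op y) :=
  ModuleCat.MonoidalCategory.tensorHom_tmul (X.map θ.op) (Y.map θ.op) x y

lemma span_tmul {X Y : GlobalRep k U} (H : U.FullSubcategory) (S : Set (X.obj (op H)))
    (T : Set (Y.obj (op H))) (hS : Submodule.span k S = ⊤) (hT : Submodule.span k T = ⊤) :
    Submodule.span k (Set.image2 (tmul (X := X) (Y := Y) (H := H)) S T) = ⊤ := by
  have h := TensorProduct.map₂_mk_top_top_eq_top (R := k) (M := X.obj (op H)) (N := Y.obj (op H))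
  rw [← hS, ← hT, Submodule.map₂_span_span] at h
  exact h

/-- Finitely generated objects are closed under tensor products. -/
lemma finGen_tensor [IsWidelyClosed U] {X Y : GlobalRep k U} (hX : finGen k U X)
    (hY : finGen k U Y) : finGen k U (X ⊗ Y) := by
  obtain ⟨n, G, x, hx⟩ := exists_generates hX
  obtain ⟨m, K, y, hy⟩ := exists_generates hY
  refine finGen_of_generates (X := X ⊗ Y)
    (ι := Σ (i : Fin n) (j : Fin m), WideSubgroup (G i) (K j)) (G := fun t => t.2.2.grp)
    (x := fun t => tmul (X.map t.2.2.fst.op (x t.1)) (Y.map t.2.2.snd.op (y t.2.1)))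
    fun H => ?_
  refine eq_top_iff.2 ((span_tmul H _ _ (hx H) (hy H)).symm.le.trans (Submodule.span_mono ?_))
  rintro _ ⟨_, ⟨i, φ, rfl⟩, _, ⟨j, ψ, rfl⟩, rfl⟩
  obtain ⟨S, θ, rfl, rfl⟩ := WideSubgroup.exists_lift φ ψ
  refine ⟨⟨i, j, S⟩, θ, ?_⟩
  rw [map_tmul, op_comp, op_comp, Functor.map_comp_apply, Functor.map_comp_apply]

/-- In the noetherian case, subobjects of finitely generated objects are finitely generated. -/
lemma finGen_of_mono [IsNoetherianFamily k U] {X Y : GlobalRep k U} (i : Y ⟶ X) [Mono i]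
    (hX : finGen k U X) : finGen k U Y := by
  obtain ⟨n, G, x, hx⟩ := exists_generates hX
  clear hX
  induction n generalizing X Y with
  | zero =>
    refine finGen_of_generates (ι := Fin 0) (G := Fin.elim0) (x := fun i => i.elim0) fun H => ?_
    have h := hx H
    have hinj : Function.Injective (i.app (op H)) :=
      (ModuleCat.mono_iff_injective _).1 inferInstance
    rw [eq_top_iff]
    rintro y -
    have h0 : ∀ z : X.obj (op H), z = 0 := by
      intro z
      have : z ∈ (⊤ : Submodule k (X.obj (op H))) := Submodule.mem_top
      rw [← h] at this
      have he : {y : X.obj (op H) | ∃ (i : Fin 0) (φ : H ⟶ G i), y = X.map φ.op (x i)} = ∅ := by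
        ext w
        simp
      rw [he, Submodule.span_empty] at this
      exact (Submodule.mem_bot k).1 this
    have : y = 0 := hinj ((h0 _).trans (h0 _).symm)
    rw [this]
    exact Submodule.zero_mem _
  | succ n ih =>
    let d := eDesc (x 0)
    refine prop_of_mono_of_cokernel (finGen k U) d
      (fun Z j hj => IsNoetherianFamily.finGen_of_mono _ _ j hj) ?_ i
    · intro Z j hj
      refine ih j (fun i => G i.succ) (fun i => (cokernel.π d).app _ (x i.succ)) fun H => ?_
      rw [eq_top_iff]
      have hs := surjective_app_of_epi (cokernel.π d) (op H)
      rintro c -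
      obtain ⟨b, rfl⟩ := hs c
      set W := Submodule.span k {y : (cokernel d).obj (op H) | ∃ (i : Fin n) (φ : H ⟶ G i.succ),
        y = (cokernel d).map φ.op ((cokernel.π d).app _ (x i.succ))} with hW
      have hb : (⊤ : Submodule k _) ≤ W.comap ((cokernel.π d).app (op H)).hom := by
        rw [← hx H, Submodule.span_le]
        rintro _ ⟨i, φ, rfl⟩
        refine Fin.cases ?_ (fun i => ?_) i φ
        · intro φ
          have e : (cokernel.π d).app (op H) (X.map φ.op (x 0)) = 0 := by
            rw [← eDesc_app (x 0) H φ]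
            change (d ≫ cokernel.π d).app (op H) _ = 0
            rw [cokernel.condition]
            rfl
          change (cokernel.π d).app (op H) (X.map φ.op (x 0)) ∈ W
          rw [e]
          exact W.zero_mem
        · intro φ
          exact Submodule.subset_span ⟨i, φ, NatTrans.naturality_apply (cokernel.π d) φ.op _⟩
      exact hb (Submodule.mem_top : b ∈ ⊤)

instance [IsNoetherianFamily k U] : (finGen k U).IsClosedUnderSubobjects where
  prop_of_mono f _ h := finGen_of_mono f h

instance : (finGen k U).IsClosedUnderFiniteProducts :=
  isClosedUnderFiniteProducts_of_extensions _

instance [IsWidelyClosed U] [(finGen k U).ContainsUnit] : (finGen k U).IsMonoidal where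
  prop_tensor _ _ h₁ h₂ := finGen_tensor h₁ h₂

variable (k U) in
/-- `A(𝒰)^c`: the full subcategory of finitely generated objects. -/
abbrev FinGenRep := (finGen k U).FullSubcategory

/-- The set `π₀(𝒰)` of isomorphism classes of objects of `𝒰`. -/
abbrev isoClasses (U : ObjectProperty FinGrpOut.{u}) : Type (u + 1) :=
  Quotient (isIsomorphicSetoid U.FullSubcategory)

/-- The support of `X`: the isomorphism classes `[G]` with `X(G) ≠ 0`. -/
def indexSupport (X : GlobalRep k U) : Set (isoClasses U) :=
  {c | ∃ G : U.FullSubcategory,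
    Quotient.mk (isIsomorphicSetoid U.FullSubcategory) G = c ∧ ¬ IsZero (X.obj (op G))}

variable (k) in
/-- The group prime `P_G`: the finitely generated `X` with `X(G) = 0`. -/
def groupPrime (G : U.FullSubcategory) : ObjectProperty (FinGenRep k U) :=
  fun X => IsZero (X.obj.obj (op G))

variable (k U) in
/-- `P_∞`: the finitely generated objects with finite support. -/
def primeInfty : ObjectProperty (FinGenRep k U) :=
  fun X => (indexSupport X.obj).Finite

variable (k) in
/-- `G 0, G 1, …` exhibits `𝒰` as an `ℕ`-stable family (over `k`). The family `𝒰` is `ℕ`-stable if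
such an enumeration exists. -/
structure IsNStableEnumeration (G : ℕ → U.FullSubcategory) : Prop where
  /-- `n ↦ [G n]` is a bijection from `ℕ` to the set of isomorphism classes -/
  bijective : Function.Bijective fun n =>
    Quotient.mk (isIsomorphicSetoid U.FullSubcategory) (G n)
  /-- for distinct indices there is an epimorphism in exactly one direction -/
  total : ∀ m n, m ≠ n → Xor (Nonempty (G m ⟶ G n)) (Nonempty (G n ⟶ G m))
  /-- the direction is consistent with the order of the indices -/
  consistent : ∀ m n, m ≤ n → Nonempty (G n ⟶ G m)
  /-- every finitely generated object is eventually torsion-free -/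
  torsionFree : ∀ X : GlobalRep k U, finGen k U X →
    ∃ r : ℕ, ∀ (m n : ℕ) (α : G m ⟶ G n), r < n → Function.Injective (X.map α.op)

end GlobalRep
end

/-! A prime `P` is tested against the objects `regularRep k (G n)`, the quotients of `e_{G_n}`
supported only at `[G_n]`.

If `x ∈ X(H)` is nonzero, then `regularRep k H` embeds into `X ⊗ regularRep k H`
(`exists_mono_regularRep`). So a prime missing `regularRep k H` contains no `X` with `X(H) ≠ 0`. If
instead `X(H) = 0`, then `X ⊗ regularRep k H = 0`, and primality puts `X` in `P`. Hence `P = P_H`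
(`eq_groupPrime_of_not_regularRep`).

If `P` contains every `regularRep k (G n)`, it contains every object of finite support, since such
an object is built from these by quotients and extensions (`prop_of_primeInfty`). It contains
nothing else. If `X` has infinite support, stability gives some `x ∈ X(G_n)` with all restrictions
nonzero, and then `e_{G_n}` embeds into `X ⊗ e_{G_n}`. The cokernel of `e_{G_n} ⟶ 𝟙` has finite
support, so `X ∈ P` would force `𝟙 ∈ P` (`primeInfty_of_prop`). Stability also makes every infinite
support cofinite, which is why `P_∞` is prime.

For the topology, the map from `OnePoint ℕ` is a continuous bijection out of a compact space. The
target is Hausdorff because each `P_n` is a clopen point. -/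

noncomputable section

/-! ### Group primes -/

section GroupPrimes

variable {k : Type u} [Field k] {U : ObjectProperty FinGrpOut.{u}}

lemma isZero_moduleCat_iff (M : ModuleCat.{u} k) : IsZero M ↔ ∀ x : M, x = 0 := by
  rw [ModuleCat.isZero_iff_subsingleton]
  exact ⟨fun h x => Subsingleton.elim _ _, fun h => ⟨fun x y => (h x).trans (h y).symm⟩⟩

lemma groupPrime_iff (G : U.FullSubcategory) (X : FinGenRep k U) :
    groupPrime k G X ↔ ∀ x : X.obj.obj (op G), x = 0 :=
  isZero_moduleCat_iff _

lemma not_groupPrime_iff (G : U.FullSubcategory) (X : FinGenRep k U) :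
    ¬ groupPrime k G X ↔ ∃ x : X.obj.obj (op G), x ≠ 0 := by
  rw [groupPrime_iff]
  push Not
  rfl

lemma groupPrime_of_iso {G H : U.FullSubcategory} (e : G ≅ H) (X : FinGenRep k U)
    (hX : groupPrime k G X) : groupPrime k H X :=
  IsZero.of_iso hX (X.obj.mapIso e.op)

/-- Over a field, linear functionals separate points: applying `f ⊗ id` to `x ⊗ y = 0` gives `f(x) y
= 0`, hence `f(x) = 0` for every `f`. -/
lemma tmul_ne_zero {X Y : GlobalRep k U} {H : U.FullSubcategory} {x : X.obj (op H)}
    {y : Y.obj (op H)} (hx : x ≠ 0) (hy : y ≠ 0) : tmul x y ≠ 0 := by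
  intro h
  refine hx ((Module.forall_dual_apply_eq_zero_iff k x).1 fun f => ?_)
  have := congrArg (TensorProduct.lid k (Y.obj (op H)) ∘ LinearMap.rTensor _ f) h
  simp only [tmul, Function.comp_apply, LinearMap.rTensor_tmul, TensorProduct.lid_tmul]
    at this
  exact (smul_eq_zero.1 this).resolve_right hy

lemma IsZero.of_forall_groupPrime {X : FinGenRep k U} (h : ∀ G, groupPrime k G X) : IsZero X := by
  rw [IsZero.iff_id_eq_zero]
  ext H x
  exact ((groupPrime_iff _ X).1 (h H.unop) _).trans ((groupPrime_iff _ X).1 (h H.unop) _).symm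

section Noetherian

variable [IsNoetherianFamily k U]

instance : PreservesFiniteLimits (finGen k U).ι := by
  have : ∀ {X Y : FinGenRep k U} (f : X ⟶ Y),
      PreservesLimit (parallelPair f 0) (finGen k U).ι :=
    fun f => (finGen k U).preservesKernels_ι f
  exact Functor.preservesFiniteLimits_of_preservesKernels _

instance : PreservesFiniteColimits (finGen k U).ι := by
  have : ∀ {X Y : FinGenRep k U} (f : X ⟶ Y),
      PreservesColimit (parallelPair f 0) (finGen k U).ι :=
    fun f => (finGen k U).preservesCokernels_ι f
  exact Functor.preservesFiniteColimits_of_preservesCokernels _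

/-- The group prime is the kernel of evaluation at `G`, which is exact on finitely generated objects
because their inclusion into `A(𝒰)` is exact. -/
instance isSerreClass_groupPrime (G : U.FullSubcategory) : (groupPrime k G).IsSerreClass :=
  inferInstanceAs (ObjectProperty.inverseImage (IsZero (C := ModuleCat.{u} k))
    ((finGen k U).ι ⋙ (evaluation _ _).obj (op G))).IsSerreClass

lemma mono_of_injective_app {X Y : FinGenRep k U} (f : X ⟶ Y)
    (h : ∀ H, Function.Injective (f.hom.app H)) : Mono f := by
  have : ∀ H, Mono (f.hom.app H) := fun H => (ModuleCat.mono_iff_injective _).2 (h H)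
  have : Mono ((finGen k U).ι.map f) := NatTrans.mono_of_mono_app f.hom
  exact (finGen k U).ι.mono_of_mono_map this

lemma surjective_app_of_epi_finGenRep {X Y : FinGenRep k U} (f : X ⟶ Y) [Epi f]
    (H : U.FullSubcategoryᵒᵖ) : Function.Surjective (f.hom.app H) := by
  have : Epi f.hom := inferInstanceAs (Epi ((finGen k U).ι.map f))
  exact surjective_app_of_epi f.hom H

variable [IsWidelyClosed U] [(finGen k U).ContainsUnit]

lemma isPrimeSerreIdeal_groupPrime (G : U.FullSubcategory) :
    IsPrimeSerreIdeal (groupPrime k G) where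
  isSerreClass := isSerreClass_groupPrime G
  tensor_mem X Y h := by
    rw [groupPrime_iff] at h ⊢
    have : Subsingleton (X.obj.obj (op G)) := ⟨fun a b => (h a).trans (h b).symm⟩
    intro z
    exact Subsingleton.elim (α := TensorProduct k (X.obj.obj (op G)) (Y.obj.obj (op G))) z 0
  ne_top h := by
    have : groupPrime k G (𝟙_ (FinGenRep k U)) := h ▸ trivial
    exact one_ne_zero (α := k) ((groupPrime_iff _ _).1 this (1 : k))
  mem_or_mem X Y h := by
    by_contra! hc
    obtain ⟨x, hx⟩ := (not_groupPrime_iff G X).1 hc.1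
    obtain ⟨y, hy⟩ := (not_groupPrime_iff G Y).1 hc.2
    exact tmul_ne_zero hx hy ((groupPrime_iff G _).1 h (tmul x y))

end Noetherian

/-- A finitely generated object has finite-dimensional values. -/
lemma finite_obj_of_finGen {X : GlobalRep k U} (hX : finGen k U X) (H : U.FullSubcategory) :
    Module.Finite k (X.obj (op H)) := by
  obtain ⟨n, G, x, hx⟩ := exists_generates hX
  have hfin : ∀ i, Finite (H ⟶ G i) := fun i => by
    have : Finite (H.obj ⟶ (G i).obj) := by
      have : Finite (H.obj →* (G i).obj) := DFunLike.finite _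
      exact Quotient.finite _
    exact Finite.of_injective (fun f : H ⟶ G i => f.hom) fun f g h => by ext; exact h
  refine ⟨Submodule.fg_def.2 ⟨_, ?_, hx H⟩⟩
  refine (Set.finite_range fun p : Σ i, (H ⟶ G i) => X.map p.2.op (x p.1)).subset ?_
  rintro y ⟨i, φ, rfl⟩
  exact ⟨⟨i, φ⟩, rfl⟩

end GroupPrimes

/-! ### Truncations of the representables `e_G` -/

lemma FinGrpOut.isIso_of_endo {G : FinGrpOut.{u}} (a : G ⟶ G) : IsIso a := by
  obtain ⟨f, hf, rfl⟩ := FinGrpOut.exists_homMk a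
  have hb : Function.Bijective f := ⟨Finite.injective_iff_surjective.2 hf, hf⟩
  let e := MulEquiv.ofBijective f hb
  refine ⟨homMk (e.symm : G →* G) e.symm.surjective, ?_, ?_⟩
  · exact congrArg (Quotient.mk (conjSetoid G G))
      (Subtype.ext (MonoidHom.ext fun x => e.symm_apply_apply x))
  · exact congrArg (Quotient.mk (conjSetoid G G))
      (Subtype.ext (MonoidHom.ext fun x => e.apply_symm_apply x))

section Cyclic

variable {k : Type u} [Field k] {U : ObjectProperty FinGrpOut.{u}}

instance isIso_of_endo_fullSubcategory {G : U.FullSubcategory} (a : G ⟶ G) : IsIso a := by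
  have : IsIso (U.ι.map a) := FinGrpOut.isIso_of_endo a.hom
  exact isIso_of_reflects_iso a U.ι

/-- Both composites are endomorphisms, hence invertible, and their inverses supply one-sided
inverses of `φ`. -/
lemma isIso_of_hom_reverse {G H : U.FullSubcategory} (φ : H ⟶ G) (ψ : G ⟶ H) : IsIso φ := by
  have h₁ : IsSplitEpi φ := ⟨⟨⟨inv (ψ ≫ φ) ≫ ψ, by simp⟩⟩⟩
  have h₂ : IsSplitMono φ := ⟨⟨⟨ψ ≫ inv (φ ≫ ψ), by simp [← Category.assoc]⟩⟩⟩
  exact isIso_of_epi_of_isSplitMono φ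

/-- A property of groups in `𝒰` that is inherited by quotients. -/
def IsQuotientClosed (S : U.FullSubcategory → Prop) : Prop :=
  ∀ ⦃H K : U.FullSubcategory⦄, (H ⟶ K) → S H → S K

/-- The combinations of morphisms `H ⟶ G` that vanish when `S H` holds. -/
def vanishing (k : Type u) [Field k] (S : U.FullSubcategory → Prop) (G H : U.FullSubcategory) :
    Submodule k ((H ⟶ G) →₀ k) where
  carrier := {c | S H → c = 0}
  add_mem' ha hb h := by rw [ha h, hb h, add_zero]
  zero_mem' _ := rfl
  smul_mem' r c hc h := by rw [hc h, smul_zero]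

variable (k) in
/-- The quotient of `e_G` with value `e_G(H)` if `S H` holds and `0` otherwise. -/
def truncObj {S : U.FullSubcategory → Prop} (hS : IsQuotientClosed S) (G : U.FullSubcategory) :
    GlobalRep k U where
  obj H := ModuleCat.of k (((H.unop ⟶ G) →₀ k) ⧸ vanishing k S G H.unop)
  map {H K} ψ := ModuleCat.ofHom (Submodule.mapQ _ _ (Finsupp.lmapDomain k k fun φ => ψ.unop ≫ φ)
    fun c hc hK => by rw [hc (hS ψ.unop hK), map_zero])
  map_id H := by
    ext x
    simp
  map_comp {H K L} ψ χ := by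
    refine ModuleCat.hom_ext (Submodule.linearMap_qext _ (Finsupp.lhom_ext' fun φ =>
      LinearMap.ext_ring (congrArg Submodule.Quotient.mk ?_)))
    change Finsupp.mapDomain _ (Finsupp.single φ (1 : k)) =
      Finsupp.mapDomain _ (Finsupp.mapDomain _ (Finsupp.single φ 1))
    rw [Finsupp.mapDomain_single, Finsupp.mapDomain_single, Finsupp.mapDomain_single, unop_comp,
      Category.assoc]

end Cyclic

section Cyclic

variable {k : Type u} [Field k] {U : ObjectProperty FinGrpOut.{u}}
  {S : U.FullSubcategory → Prop} (hS : IsQuotientClosed S) {G H K : U.FullSubcategory}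

variable (k) in
/-- The class of a morphism `H ⟶ G` in the truncation of `e_G`. -/
def truncMk (φ : H ⟶ G) : (truncObj k hS G).obj (op H) :=
  Submodule.Quotient.mk (Finsupp.single φ (1 : k))

lemma map_truncMk (ψ : K ⟶ H) (φ : H ⟶ G) :
    (truncObj k hS G).map ψ.op (truncMk k hS φ) = truncMk k hS (ψ ≫ φ) := by
  change Submodule.Quotient.mk (Finsupp.mapDomain _ (Finsupp.single φ (1 : k))) = _
  rw [Finsupp.mapDomain_single]
  rfl

lemma span_truncMk (G H : U.FullSubcategory) :
    Submodule.span k (Set.range fun φ : H ⟶ G => truncMk k hS φ) = ⊤ := by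
  have h := congrArg (Submodule.map (vanishing k S G H).mkQ)
    (Finsupp.basisSingleOne (R := k) (ι := H ⟶ G)).span_eq
  rw [Submodule.map_span, Submodule.map_top, Submodule.range_mkQ, ← Set.range_comp] at h
  exact h

lemma truncObj_eq_zero (hH : ¬ S H) (z : (truncObj k hS G).obj (op H)) : z = 0 := by
  obtain ⟨c, rfl⟩ := Submodule.mkQ_surjective _ z
  exact (Submodule.Quotient.mk_eq_zero _).2 fun h => absurd h hH

lemma truncObj_eq_zero_of_isEmpty (h : IsEmpty (H ⟶ G)) (z : (truncObj k hS G).obj (op H)) :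
    z = 0 := by
  have hz : z ∈ Submodule.span k (Set.range fun φ : H ⟶ G => truncMk k hS φ) := by
    rw [span_truncMk]
    exact Submodule.mem_top
  rw [Set.range_eq_empty, Submodule.span_empty] at hz
  exact (Submodule.mem_bot k).1 hz

/-- The coefficient of a morphism, at a group where the truncation of `e_G` agrees with `e_G`. -/
def truncCoeff (hH : S H) (φ : H ⟶ G) : (truncObj k hS G).obj (op H) →ₗ[k] k :=
  Submodule.liftQ _ (Finsupp.lapply φ) fun c hc => by rw [hc hH]; exact Submodule.zero_mem _

lemma truncMk_ne_zero (hH : S H) (φ : H ⟶ G) : truncMk k hS φ ≠ 0 := by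
  intro h
  have := congrArg (truncCoeff hS hH φ) h
  rw [map_zero] at this
  exact one_ne_zero (α := k) (Finsupp.single_eq_same.symm.trans this)

lemma finGen_truncObj (G : U.FullSubcategory) : finGen k U (truncObj k hS G) := by
  refine finGen_of_generates (ι := Unit) (G := fun _ => G) (x := fun _ => truncMk k hS (𝟙 G))
    fun H => ?_
  rw [← span_truncMk hS G H]
  congr 1
  ext y
  constructor
  · rintro ⟨-, φ, rfl⟩
    exact ⟨φ, by rw [map_truncMk, Category.comp_id]⟩
  · rintro ⟨φ, rfl⟩
    exact ⟨⟨⟩, φ, by rw [map_truncMk, Category.comp_id]⟩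

variable {X : GlobalRep k U}

/-- The map out of a truncation of `e_G` classified by an element `x ∈ X(G)` which restricts to
zero on the groups where the truncation vanishes. -/
def truncDesc (x : X.obj (op G)) (hx : ∀ (H : U.FullSubcategory) (φ : H ⟶ G), ¬ S H →
    X.map φ.op x = 0) : truncObj k hS G ⟶ X where
  app H := ModuleCat.ofHom (Submodule.liftQ _
    (Finsupp.linearCombination k fun φ : H.unop ⟶ G => X.map φ.op x) fun c hc => by
      by_cases hH : S H.unop
      · rw [hc hH]
        exact Submodule.zero_mem _
      · simp [Finsupp.linearCombination_apply, hx _ _ hH])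
  naturality H K φ := by
    refine ModuleCat.hom_ext (Submodule.linearMap_qext _ (Finsupp.lhom_ext' fun ψ =>
      LinearMap.ext_ring ?_))
    change Finsupp.linearCombination k (fun φ : K.unop ⟶ G => X.map φ.op x)
      (Finsupp.mapDomain (fun ψ => φ.unop ≫ ψ) (Finsupp.single ψ 1)) =
      X.map φ (Finsupp.linearCombination k (fun φ : H.unop ⟶ G => X.map φ.op x)
        (Finsupp.single ψ 1))
    rw [Finsupp.mapDomain_single, Finsupp.linearCombination_single,
      Finsupp.linearCombination_single, one_smul, one_smul, op_comp, Functor.map_comp_apply]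
    rfl

lemma truncDesc_truncMk (x : X.obj (op G)) (hx) (φ : H ⟶ G) :
    (truncDesc hS x hx).app (op H) (truncMk k hS φ) = X.map φ.op x := by
  refine (Submodule.liftQ_apply _ _ _).trans ?_
  rw [Finsupp.linearCombination_single, one_smul]

/-- If `x ∈ X(G)` restricts to nonzero elements, then the truncation of `e_G` embeds into its tensor
product with `X`. -/
lemma injective_truncDesc_tmul (x : X.obj (op G))
    (hx : ∀ (H : U.FullSubcategory) (φ : H ⟶ G), S H → X.map φ.op x ≠ 0) (h) :
    Function.Injective ((truncDesc (X := X ⊗ truncObj k hS G) hS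
      (tmul x (truncMk k hS (𝟙 G))) h).app (op H)) := by
  by_cases hH : S H
  swap
  · exact fun a b _ => (truncObj_eq_zero hS hH a).trans (truncObj_eq_zero hS hH b).symm
  refine (injective_iff_map_eq_zero (ModuleCat.Hom.hom _)).2 fun z hz => ?_
  obtain ⟨c, rfl⟩ := Submodule.mkQ_surjective _ z
  refine (Submodule.Quotient.mk_eq_zero _).2 fun _ => ?_
  ext φ
  -- The map sends `∑ c_ψ [ψ]` to `∑ ψ^*x ⊗ [ψ]` weighted by the `c_ψ`; `L` reads off the `φ`-term
  -- `c_φ φ^*x`, so `φ^*x ≠ 0` forces `c_φ = 0`.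
  let L : (X ⊗ truncObj k hS G).obj (op H) →ₗ[k] X.obj (op H) :=
    (TensorProduct.rid k _).toLinearMap ∘ₗ LinearMap.lTensor _ (truncCoeff hS hH φ)
  have key : L ∘ₗ ((truncDesc (X := X ⊗ truncObj k hS G) hS
      (tmul x (truncMk k hS (𝟙 G))) h).app (op H)).hom ∘ₗ (vanishing k S G H).mkQ =
      (LinearMap.toSpanSingleton k _ (X.map φ.op x)) ∘ₗ Finsupp.lapply φ := by
    refine Finsupp.lhom_ext' fun ψ => LinearMap.ext_ring ?_
    change L ((truncDesc (X := X ⊗ truncObj k hS G) hS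
      (tmul x (truncMk k hS (𝟙 G))) h).app (op H) (truncMk k hS ψ)) = _
    rw [truncDesc_truncMk, map_tmul, map_truncMk]
    change Finsupp.single (ψ ≫ 𝟙 G) (1 : k) φ • X.map ψ.op x =
      Finsupp.single ψ (1 : k) φ • X.map φ.op x
    rw [Category.comp_id]
    by_cases e : ψ = φ
    · rw [e]
    · rw [Finsupp.single_eq_of_ne' e, zero_smul, zero_smul]
  have h' : c φ • X.map φ.op x = 0 :=
    (LinearMap.congr_fun key c).symm.trans ((congrArg L hz).trans (map_zero L))
  exact (smul_eq_zero.1 h').resolve_right (hx H φ hH)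

/-- With this condition the truncation of `e_G` can be nonzero at `H` only if there are morphisms `G
⟶ H` and `H ⟶ G`, that is, only if `H ≅ G`. -/
lemma isQuotientClosed_hom (G : U.FullSubcategory) :
    IsQuotientClosed fun H : U.FullSubcategory => Nonempty (G ⟶ H) :=
  fun _ _ φ ⟨ψ⟩ => ⟨ψ ≫ φ⟩

/-- The trivial condition truncates nothing, so `injective_truncDesc_tmul` covers both `e_G` and its
quotient concentrated at `G`. -/
lemma isQuotientClosed_true : IsQuotientClosed fun _ : U.FullSubcategory => True :=
  fun _ _ _ _ => trivial

variable (k) in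
/-- The representable functor `e_G` as a finitely generated object. -/
def projRep (G : U.FullSubcategory) : FinGenRep k U :=
  ⟨truncObj k isQuotientClosed_true G, finGen_truncObj _ G⟩

variable (k) in
/-- The quotient of `e_G` concentrated at `G`, which is the regular representation of `Out(G)`. -/
def regularRep (G : U.FullSubcategory) : FinGenRep k U :=
  ⟨truncObj k (isQuotientClosed_hom G) G, finGen_truncObj _ G⟩

lemma groupPrime_projRep_iff : groupPrime k H (projRep k G) ↔ IsEmpty (H ⟶ G) := by
  rw [groupPrime_iff]
  exact ⟨fun h => ⟨fun φ => truncMk_ne_zero isQuotientClosed_true trivial φ (h _)⟩,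
    fun h z => truncObj_eq_zero_of_isEmpty isQuotientClosed_true h z⟩

lemma groupPrime_regularRep_iff : groupPrime k H (regularRep k G) ↔ IsEmpty (H ≅ G) := by
  rw [groupPrime_iff]
  refine ⟨fun h => ⟨fun e => truncMk_ne_zero (isQuotientClosed_hom G) ⟨e.inv⟩ e.hom (h _)⟩,
    fun h z => ?_⟩
  by_cases hH : Nonempty (G ⟶ H)
  · refine truncObj_eq_zero_of_isEmpty (isQuotientClosed_hom G) ⟨fun φ => h.elim ?_⟩ z
    have := isIso_of_hom_reverse φ hH.some
    exact asIso φ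
  · exact truncObj_eq_zero (isQuotientClosed_hom G) hH z

end Cyclic

/-! ### Maps and embeddings that test membership in a prime -/

section Embeddings

variable {k : Type u} [Field k] {U : ObjectProperty FinGrpOut.{u}}

/-- The condition on `x` says exactly that the map `e_H ⟶ X` classified by `x` factors through the
quotient concentrated at `H`. -/
lemma exists_hom_regularRep (X : FinGenRep k U) {H : U.FullSubcategory} (x : X.obj.obj (op H))
    (hx : ∀ (K : U.FullSubcategory) (φ : K ⟶ H), IsEmpty (H ⟶ K) → X.obj.map φ.op x = 0) :
    ∃ (f : regularRep k H ⟶ X) (z : (regularRep k H).obj.obj (op H)), f.hom.app (op H) z = x := by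
  have hS := isQuotientClosed_hom H
  have h : ∀ (K : U.FullSubcategory) (φ : K ⟶ H), ¬ Nonempty (H ⟶ K) → X.obj.map φ.op x = 0 :=
    fun K φ hK => hx K φ (not_nonempty_iff.1 hK)
  refine ⟨ObjectProperty.homMk (truncDesc hS x h), truncMk k hS (𝟙 H), ?_⟩
  refine (truncDesc_truncMk hS x h _).trans ?_
  rw [op_id, X.obj.map_id]
  rfl

variable [IsWidelyClosed U] [(finGen k U).ContainsUnit]

/-- The map classified by `1 ∈ k` sends each basis element `φ : K ⟶ H` to `1`, so one such `φ`
suffices for surjectivity at `K`. -/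
lemma exists_hom_projRep_unit (H : U.FullSubcategory) :
    ∃ f : projRep k H ⟶ 𝟙_ (FinGenRep k U), ∀ K : U.FullSubcategory, (K ⟶ H) →
      Function.Surjective (f.hom.app (op K)) := by
  have h : ∀ (K : U.FullSubcategory) (φ : K ⟶ H), ¬ True →
      (𝟙_ (GlobalRep k U)).map φ.op (1 : k) = 0 := fun _ _ hK => absurd trivial hK
  refine ⟨ObjectProperty.homMk (truncDesc isQuotientClosed_true _ h), fun K φ y => ?_⟩
  let y' : k := y
  refine ⟨y' • truncMk k isQuotientClosed_true φ, ?_⟩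
  refine (map_smul (ModuleCat.Hom.hom _) y' _).trans ?_
  refine (congrArg (y' • ·) (truncDesc_truncMk isQuotientClosed_true _ h φ)).trans ?_
  exact mul_one y'

variable [IsNoetherianFamily k U]

lemma exists_mono_regularRep (X : FinGenRep k U) {H : U.FullSubcategory} (x : X.obj.obj (op H))
    (hx : x ≠ 0) : ∃ f : regularRep k H ⟶ X ⊗ regularRep k H, Mono f := by
  have hS := isQuotientClosed_hom H
  have h : ∀ (K : U.FullSubcategory) (φ : K ⟶ H), ¬ Nonempty (H ⟶ K) →
      (X.obj ⊗ truncObj k hS H).map φ.op (tmul x (truncMk k hS (𝟙 H))) = 0 := by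
    intro K φ hK
    rw [map_tmul, map_truncMk, truncObj_eq_zero hS hK (truncMk k hS _)]
    exact TensorProduct.tmul_zero _ _
  refine ⟨ObjectProperty.homMk (truncDesc hS _ h), mono_of_injective_app _ fun K =>
    injective_truncDesc_tmul hS x (fun K φ ⟨ψ⟩ h0 => hx ?_) h⟩
  -- Where the truncation survives, `φ` is invertible, so restriction along it cannot kill `x`.
  have := isIso_of_hom_reverse φ ψ
  rw [← CategoryTheory.id_apply (X := X.obj.obj (op H)) x, ← X.obj.map_id, ← op_id,
    ← IsIso.inv_hom_id φ, op_comp, Functor.map_comp_apply, h0, map_zero]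

lemma exists_mono_projRep (X : FinGenRep k U) {H : U.FullSubcategory} (x : X.obj.obj (op H))
    (hx : ∀ (K : U.FullSubcategory) (φ : K ⟶ H), X.obj.map φ.op x ≠ 0) :
    ∃ f : projRep k H ⟶ X ⊗ projRep k H, Mono f := by
  have hS : IsQuotientClosed fun _ : U.FullSubcategory => True := isQuotientClosed_true
  refine ⟨ObjectProperty.homMk (truncDesc (X := X.obj ⊗ truncObj k hS H) hS
    (tmul x (truncMk k hS (𝟙 H))) fun K φ hK => absurd trivial hK), ?_⟩
  exact mono_of_injective_app _ fun K =>
    injective_truncDesc_tmul hS x (fun K φ _ => hx K φ) fun K φ hK => absurd trivial hK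

lemma eq_groupPrime_of_not_regularRep {P : ObjectProperty (FinGenRep k U)}
    (hP : IsPrimeSerreIdeal P) {H : U.FullSubcategory} (hH : ¬ P (regularRep k H)) :
    P = groupPrime k H := by
  have := hP.isSerreClass
  ext X
  constructor
  · intro hX
    by_contra hc
    obtain ⟨x, hx⟩ := (not_groupPrime_iff H X).1 hc
    obtain ⟨f, _⟩ := exists_mono_regularRep X x hx
    exact hH (P.prop_of_mono f (hP.tensor_mem _ _ hX))
  · intro hX
    -- The tensor product vanishes everywhere: away from `[H]` because of the second factor, at
    -- `[H]` because of `X`.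
    refine (hP.mem_or_mem X (regularRep k H) (P.prop_of_isZero
      (IsZero.of_forall_groupPrime fun K => ?_))).resolve_right hH
    by_cases hK : IsEmpty (K ≅ H)
    -- The ideal property absorbs tensor factors on the right, so the braiding first moves
    -- `regularRep k H` to the left.
    · exact (groupPrime k K).prop_of_iso (β_ _ _)
        ((isPrimeSerreIdeal_groupPrime K).tensor_mem _ _ (groupPrime_regularRep_iff.2 hK))
    · rw [not_isEmpty_iff] at hK
      exact (isPrimeSerreIdeal_groupPrime K).tensor_mem _ _ (groupPrime_of_iso hK.some.symm X hX)

end Embeddings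

/-! ### Classification of the primes of an `ℕ`-stable family -/

namespace IsNStableEnumeration

variable {k : Type u} [Field k] {U : ObjectProperty FinGrpOut.{u}} {G : ℕ → U.FullSubcategory}
  (hG : IsNStableEnumeration k G)

lemma exists_iso (hG : IsNStableEnumeration k G) (H : U.FullSubcategory) :
    ∃ n, Nonempty (G n ≅ H) := by
  obtain ⟨n, hn⟩ := hG.bijective.2 (Quotient.mk _ H)
  exact ⟨n, Quotient.exact hn⟩

lemma isEmpty_hom (hG : IsNStableEnumeration k G) {m n : ℕ} (h : m < n) :
    IsEmpty (G m ⟶ G n) := by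
  have h₁ := hG.consistent m n h.le
  rcases hG.total m n h.ne with h₂ | h₂
  · exact absurd h₁ h₂.2
  · exact not_nonempty_iff.1 h₂.2

lemma nonempty_hom_iff (hG : IsNStableEnumeration k G) {m n : ℕ} :
    Nonempty (G m ⟶ G n) ↔ n ≤ m :=
  ⟨fun ⟨φ⟩ => not_lt.1 fun h => (hG.isEmpty_hom h).false φ, hG.consistent n m⟩

lemma isEmpty_iso (hG : IsNStableEnumeration k G) {m n : ℕ} (h : m ≠ n) :
    IsEmpty (G m ≅ G n) :=
  ⟨fun e => h (le_antisymm (hG.nonempty_hom_iff.1 ⟨e.inv⟩) (hG.nonempty_hom_iff.1 ⟨e.hom⟩))⟩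

lemma groupPrime_regularRep (hG : IsNStableEnumeration k G) {m n : ℕ} :
    groupPrime k (G m) (regularRep k (G n)) ↔ m ≠ n := by
  rw [groupPrime_regularRep_iff]
  refine ⟨?_, hG.isEmpty_iso⟩
  rintro h rfl
  exact h.false (Iso.refl _)

lemma groupPrime_projRep (hG : IsNStableEnumeration k G) {m n : ℕ} :
    groupPrime k (G m) (projRep k (G n)) ↔ m < n := by
  rw [groupPrime_projRep_iff, ← not_nonempty_iff, hG.nonempty_hom_iff, not_le]

lemma primeInfty_iff (hG : IsNStableEnumeration k G) (X : FinGenRep k U) :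
    primeInfty k U X ↔ ∃ N, ∀ m, N ≤ m → groupPrime k (G m) X := by
  have himg : indexSupport X.obj = (fun n => Quotient.mk (isIsomorphicSetoid U.FullSubcategory)
      (G n)) '' {n | ¬ groupPrime k (G n) X} := by
    ext c
    constructor
    · rintro ⟨H, rfl, hH⟩
      obtain ⟨n, ⟨e⟩⟩ := hG.exists_iso H
      exact ⟨n, fun h => hH (groupPrime_of_iso e X h), Quotient.sound ⟨e⟩⟩
    · rintro ⟨n, hn, rfl⟩
      exact ⟨G n, rfl, hn⟩
  rw [primeInfty, himg, Set.finite_image_iff hG.bijective.1.injOn]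
  constructor
  · intro h
    obtain ⟨N, hN⟩ := h.bddAbove
    exact ⟨N + 1, fun m hm => by_contra fun hc => absurd (hN hc) (by omega)⟩
  · rintro ⟨N, hN⟩
    exact (Set.finite_lt_nat N).subset fun m hm => not_le.1 fun h => hm (hN m h)

lemma forall_groupPrime_of_forall (hG : IsNStableEnumeration k G) {X : FinGenRep k U}
    (h : ∀ n, groupPrime k (G n) X) (H : U.FullSubcategory) : groupPrime k H X := by
  obtain ⟨n, ⟨e⟩⟩ := hG.exists_iso H
  exact groupPrime_of_iso e X (h n)

/-- Far out, nonzero elements have nonzero restrictions. -/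
lemma exists_forall_map_ne_zero (hG : IsNStableEnumeration k G) (X : FinGenRep k U) :
    ∃ r, ∀ n, r < n → ∀ (x : X.obj.obj (op (G n))), x ≠ 0 →
      ∀ (K : U.FullSubcategory) (φ : K ⟶ G n), X.obj.map φ.op x ≠ 0 := by
  obtain ⟨r, hr⟩ := hG.torsionFree X.obj X.property
  refine ⟨r, fun n hn x hx K φ h => hx ?_⟩
  obtain ⟨m, ⟨e⟩⟩ := hG.exists_iso K
  refine hr m n (e.hom ≫ φ) hn ?_
  rw [op_comp, Functor.map_comp_apply, h, map_zero, map_zero]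

/-- Infinite support is cofinite: a nonzero element at one index in the torsion-free range restricts
to nonzero elements at all later indices. -/
lemma exists_forall_not_groupPrime (hG : IsNStableEnumeration k G) {X : FinGenRep k U}
    (hX : ¬ primeInfty k U X) : ∃ r, ∀ m, r < m → ¬ groupPrime k (G m) X := by
  simp only [hG.primeInfty_iff, not_exists, not_forall] at hX
  obtain ⟨r, hr⟩ := hG.exists_forall_map_ne_zero X
  obtain ⟨n, hn, hXn⟩ := hX (r + 1)
  obtain ⟨x, hx⟩ := (not_groupPrime_iff _ _).1 hXn
  exact ⟨n, fun m hm => (not_groupPrime_iff _ _).2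
    ⟨_, hr n hn x hx (G m) (hG.consistent n m hm.le).some⟩⟩

variable [IsNoetherianFamily k U]

/-- Induction on the total dimension of the values below a fixed bound `N`: a nonzero element at the
last index of the support is hit by a map from a regular representation, and passing to the cokernel
lowers the dimension. -/
lemma prop_of_primeInfty (hG : IsNStableEnumeration k G) {P : ObjectProperty (FinGenRep k U)}
    [P.IsSerreClass] (hP : ∀ n, P (regularRep k (G n))) {X : FinGenRep k U}
    (hX : primeInfty k U X) : P X := by
  rw [hG.primeInfty_iff] at hX
  obtain ⟨N, hN⟩ := hX
  induction hd : ∑ m ∈ Finset.range N, Module.finrank k (X.obj.obj (op (G m)))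
    using Nat.strong_induction_on generalizing X with
  | _ d ih =>
  classical
  have hex : ∃ N, ∀ m, N ≤ m → groupPrime k (G m) X := ⟨N, hN⟩
  obtain ⟨M, hM, hmin⟩ : ∃ M, (∀ m, M ≤ m → groupPrime k (G m) X) ∧
      ∀ M' < M, ¬ ∀ m, M' ≤ m → groupPrime k (G m) X :=
    ⟨Nat.find hex, Nat.find_spec hex, fun _ h => Nat.find_min hex h⟩
  rcases M with _ | M
  · exact P.prop_of_isZero (IsZero.of_forall_groupPrime
      (hG.forall_groupPrime_of_forall fun n => hM n n.zero_le))
  have hXM : ¬ groupPrime k (G M) X := fun h => hmin M M.lt_succ_self fun m hm => by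
    rcases hm.eq_or_lt with rfl | hm
    · exact h
    · exact hM m hm
  obtain ⟨x, hx⟩ := (not_groupPrime_iff _ _).1 hXM
  -- Now `M` is the last index of the support. A group over `G M` that is not a quotient of it has
  -- index above `M`, where `X` vanishes.
  obtain ⟨f, z, hz⟩ := exists_hom_regularRep X x fun K φ hK => by
    obtain ⟨m, ⟨e⟩⟩ := hG.exists_iso K
    have hle : M ≤ m := hG.nonempty_hom_iff.1 ⟨e.hom ≫ φ⟩
    have hlt : M + 1 ≤ m := Nat.lt_of_le_of_ne hle fun h => hK.false (by subst h; exact e.hom)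
    exact (groupPrime_iff _ _).1 (groupPrime_of_iso e X (hM m hlt)) _
  have hfin : ∀ H, Module.Finite k (X.obj.obj (op H)) := finite_obj_of_finGen X.property
  have hsurj := fun H => surjective_app_of_epi_finGenRep (cokernel.π f) H
  have hMN : M < N := not_le.1 fun h => hXM (hN M h)
  -- Exactness in the middle is enough, so `f` need not be a monomorphism.
  refine P.prop_X₂_of_exact (ShortComplex.exact_cokernel f) (hP M)
    (ih _ ?_ (X := cokernel f) (fun m hm => ?_) rfl)
  · rw [← hd]
    refine Finset.sum_lt_sum (fun m _ => ?_) ⟨M, Finset.mem_range.2 hMN, ?_⟩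
    · exact LinearMap.finrank_le_finrank_of_surjective
        (f := ((cokernel.π f).hom.app (op (G m))).hom) (hsurj _)
    · let g := ((cokernel.π f).hom.app (op (G M))).hom
      have hker : x ∈ LinearMap.ker g := by
        change (cokernel.π f).hom.app (op (G M)) x = 0
        rw [← hz]
        change (f ≫ cokernel.π f).hom.app (op (G M)) z = 0
        rw [cokernel.condition]
        rfl
      have hpos : 0 < Module.finrank k (LinearMap.ker g) :=
        Module.finrank_pos_iff_exists_ne_zero.2 ⟨⟨x, hker⟩, fun h => hx (congrArg Subtype.val h)⟩
      have hrk := LinearMap.finrank_range_add_finrank_ker g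
      rw [LinearMap.range_eq_top.2 (hsurj _), finrank_top] at hrk
      omega
  · exact (groupPrime k (G m)).prop_of_epi (cokernel.π f) (hN m hm)

variable [IsWidelyClosed U] [(finGen k U).ContainsUnit]

open ZeroObject in
lemma isPrimeSerreIdeal_primeInfty (hG : IsNStableEnumeration k G) :
    IsPrimeSerreIdeal (primeInfty k U) where
  isSerreClass :=
    { exists_zero := ⟨0, isZero_zero _, (hG.primeInfty_iff _).2
        ⟨0, fun m _ => (groupPrime k (G m)).prop_of_isZero (isZero_zero _)⟩⟩
      prop_of_mono := fun f _ h => by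
        rw [hG.primeInfty_iff] at h ⊢
        obtain ⟨N, hN⟩ := h
        exact ⟨N, fun m hm => (groupPrime k (G m)).prop_of_mono f (hN m hm)⟩
      prop_of_epi := fun f _ h => by
        rw [hG.primeInfty_iff] at h ⊢
        obtain ⟨N, hN⟩ := h
        exact ⟨N, fun m hm => (groupPrime k (G m)).prop_of_epi f (hN m hm)⟩
      prop_X₂_of_shortExact := fun hS h₁ h₃ => by
        rw [hG.primeInfty_iff] at h₁ h₃ ⊢
        obtain ⟨N, hN⟩ := h₁
        obtain ⟨M, hM⟩ := h₃
        exact ⟨max N M, fun m hm => (groupPrime k (G m)).prop_X₂_of_shortExact hS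
          (hN m (le_of_max_le_left hm)) (hM m (le_of_max_le_right hm))⟩ }
  tensor_mem X Y h := by
    rw [hG.primeInfty_iff] at h ⊢
    obtain ⟨N, hN⟩ := h
    exact ⟨N, fun m hm => (isPrimeSerreIdeal_groupPrime (G m)).tensor_mem X Y (hN m hm)⟩
  ne_top h := by
    obtain ⟨N, hN⟩ := (hG.primeInfty_iff (𝟙_ (FinGenRep k U))).1 (h ▸ trivial)
    exact one_ne_zero (α := k) ((groupPrime_iff _ _).1 (hN N le_rfl) (1 : k))
  mem_or_mem X Y h := by
    by_contra! hc
    rw [hG.primeInfty_iff] at h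
    obtain ⟨hX, hY⟩ := hc
    obtain ⟨r, hr⟩ := hG.exists_forall_not_groupPrime hX
    obtain ⟨s, hs⟩ := hG.exists_forall_not_groupPrime hY
    obtain ⟨N, hN⟩ := h
    -- This index lies where `X ⊗ Y` vanishes and also strictly beyond `r` and `s`, where neither
    -- factor does.
    have hm : N ≤ r + s + N + 1 := by omega
    rcases (isPrimeSerreIdeal_groupPrime (k := k) (G (r + s + N + 1))).mem_or_mem X Y (hN _ hm)
      with h | h
    · exact hr _ (by omega) h
    · exact hs _ (by omega) h

/-- An object of infinite support in `P` would drag some `e_{G_n}` into `P`, and then the unit,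
which agrees with a quotient of `e_{G_n}` up to finite support. -/
lemma primeInfty_of_prop (hG : IsNStableEnumeration k G) {P : ObjectProperty (FinGenRep k U)}
    (hP : IsPrimeSerreIdeal P) (hreg : ∀ n, P (regularRep k (G n))) {X : FinGenRep k U}
    (hX : P X) : primeInfty k U X := by
  have := hP.isSerreClass
  by_contra hc
  simp only [hG.primeInfty_iff, not_exists, not_forall] at hc
  obtain ⟨r, hr⟩ := hG.exists_forall_map_ne_zero X
  obtain ⟨n, hn, hXn⟩ := hc (r + 1)
  obtain ⟨x, hx⟩ := (not_groupPrime_iff _ _).1 hXn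
  obtain ⟨f, _⟩ := exists_mono_projRep X x (hr n hn x hx)
  have hproj : P (projRep k (G n)) := P.prop_of_mono f (hP.tensor_mem _ _ hX)
  obtain ⟨g, hg⟩ := exists_hom_projRep_unit (k := k) (G n)
  have hunit : P (𝟙_ (FinGenRep k U)) := by
    refine P.prop_X₂_of_exact (ShortComplex.exact_cokernel g) hproj
      (hG.prop_of_primeInfty hreg ((hG.primeInfty_iff _).2 ⟨n, fun m hm => ?_⟩))
    refine (groupPrime_iff _ _).2 fun y => ?_
    obtain ⟨w, rfl⟩ := surjective_app_of_epi_finGenRep (cokernel.π g) (op (G m)) y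
    obtain ⟨v, rfl⟩ := hg (G m) (hG.consistent n m hm).some w
    change (g ≫ cokernel.π g).hom.app (op (G m)) v = 0
    rw [cokernel.condition]
    rfl
  refine hP.ne_top (eq_top_iff.2 fun Y _ => ?_)
  exact P.prop_of_iso (λ_ Y) (hP.tensor_mem _ Y hunit)

lemma isPrimeSerreIdeal_iff (hG : IsNStableEnumeration k G) (P : ObjectProperty (FinGenRep k U)) :
    IsPrimeSerreIdeal P ↔ (∃ n : ℕ, P = groupPrime k (G n)) ∨ P = primeInfty k U := by
  constructor
  · intro hP
    by_cases h : ∀ n, P (regularRep k (G n))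
    · right
      have := hP.isSerreClass
      ext X
      exact ⟨hG.primeInfty_of_prop hP h, hG.prop_of_primeInfty h⟩
    · push Not at h
      exact Or.inl (h.imp fun n hn => eq_groupPrime_of_not_regularRep hP hn)
  · rintro (⟨n, rfl⟩ | rfl)
    · exact isPrimeSerreIdeal_groupPrime _
    · exact hG.isPrimeSerreIdeal_primeInfty

end IsNStableEnumeration

/-! ### Closed sets and continuity for the Zariski topology -/

section SpcTopology

variable {C : Type w} [Category.{v} C] [Abelian C] [MonoidalCategory C]

lemma Spc.isClosed_iff (T : Set (Spc C)) : IsClosed T ↔ ∃ S : Set C, T = Spc.zeroLocus S := by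
  rw [← isOpen_compl_iff]
  change Tᶜᶜ ∈ {T | ∃ S : Set C, T = Spc.zeroLocus S} ↔ _
  rw [compl_compl]
  rfl

lemma Spc.isClosed_notMem (X : C) : IsClosed {P : Spc C | ¬ P.carrier X} :=
  (Spc.isClosed_iff _).2 ⟨{X}, by ext P; simp [Spc.zeroLocus]⟩

lemma Spc.continuous_of_isClosed {T : Type*} [TopologicalSpace T] {f : T → Spc C}
    (h : ∀ X, IsClosed {t | ¬ (f t).carrier X}) : Continuous f := by
  refine continuous_iff_isClosed.2 fun Z hZ => ?_
  obtain ⟨S, rfl⟩ := (Spc.isClosed_iff _).1 hZ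
  have : f ⁻¹' Spc.zeroLocus S = ⋂ X ∈ S, {t | ¬ (f t).carrier X} := by
    ext t
    simp [Spc.zeroLocus]
  rw [this]
  exact isClosed_biInter fun X _ => h X

end SpcTopology

/-! ### The homeomorphism with the one-point compactification -/

namespace IsNStableEnumeration

variable {k : Type u} [Field k] {U : ObjectProperty FinGrpOut.{u}} {G : ℕ → U.FullSubcategory}
  [IsNoetherianFamily k U] [IsWidelyClosed U] [(finGen k U).ContainsUnit]

/-- The group primes together with `P_∞`, as a family of points indexed by `ℕ ∪ {∞}`. -/
def spcPoint (hG : IsNStableEnumeration k G) : OnePoint ℕ → Spc (FinGenRep k U)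
  | OnePoint.infty => ⟨primeInfty k U, hG.isPrimeSerreIdeal_primeInfty⟩
  | OnePoint.some n => ⟨groupPrime k (G n), isPrimeSerreIdeal_groupPrime _⟩

lemma spcPoint_carrier_regularRep (hG : IsNStableEnumeration k G) (t : OnePoint ℕ) (n : ℕ) :
    (hG.spcPoint t).carrier (regularRep k (G n)) ↔ t ≠ n := by
  induction t using OnePoint.rec with
  | infty =>
    refine iff_of_true ((hG.primeInfty_iff _).2 ⟨n + 1, fun m hm => ?_⟩) (OnePoint.infty_ne_coe n)
    exact hG.groupPrime_regularRep.2 (by omega)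
  | coe m => exact hG.groupPrime_regularRep.trans (by simp)

/-- Regular representations separate the points: `P_n` omits only the `n`-th one, and `P_∞` omits
none. Surjectivity is the classification. -/
lemma spcPoint_bijective (hG : IsNStableEnumeration k G) : Function.Bijective hG.spcPoint := by
  constructor
  · intro s t h
    have hst : ∀ n : ℕ, s = n ↔ t = n := fun n => by
      rw [← not_iff_not, ← ne_eq, ← ne_eq, ← hG.spcPoint_carrier_regularRep, h,
        hG.spcPoint_carrier_regularRep]
    induction s using OnePoint.rec with
    | infty =>
      induction t using OnePoint.rec with
      | infty => rfl
      | coe n => exact (hst n).2 rfl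
    | coe n => exact ((hst n).1 rfl).symm
  · rintro ⟨P, hP⟩
    rcases (hG.isPrimeSerreIdeal_iff P).1 hP with ⟨n, rfl⟩ | rfl
    · exact ⟨(n : OnePoint ℕ), rfl⟩
    · exact ⟨OnePoint.infty, rfl⟩

/-- The preimage of `{P | X ∉ P}` is the set of indices in the support of `X`, together with `∞`
when that set is infinite. A finite subset of `ℕ` is closed in `OnePoint ℕ`, and so is every set
containing `∞`. -/
lemma continuous_spcPoint (hG : IsNStableEnumeration k G) : Continuous hG.spcPoint := by
  refine Spc.continuous_of_isClosed fun X => ?_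
  by_cases hX : primeInfty k U X
  · have hmem : OnePoint.infty ∉ {t | ¬ (hG.spcPoint t).carrier X} := fun h => h hX
    rw [OnePoint.isClosed_iff_of_notMem hmem]
    refine ⟨isClosed_discrete _, Set.Finite.isCompact ?_⟩
    obtain ⟨N, hN⟩ := (hG.primeInfty_iff X).1 hX
    exact (Set.finite_lt_nat N).subset fun m hm => not_le.1 fun h => hm (hN m h)
  · have hmem : OnePoint.infty ∈ {t | ¬ (hG.spcPoint t).carrier X} := hX
    rw [OnePoint.isClosed_iff_of_mem hmem]
    exact isClosed_discrete _

lemma isClosed_singleton_spcPoint (hG : IsNStableEnumeration k G) (n : ℕ) :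
    IsClosed {hG.spcPoint n} := by
  convert Spc.isClosed_notMem (regularRep k (G n))
  ext P
  obtain ⟨t, rfl⟩ := hG.spcPoint_bijective.2 P
  simp [hG.spcPoint_carrier_regularRep, hG.spcPoint_bijective.1.eq_iff]

lemma isOpen_singleton_spcPoint (hG : IsNStableEnumeration k G) (n : ℕ) :
    IsOpen {hG.spcPoint n} := by
  -- The support of `e_{G_{n+1}}` consists of the indices `m ≥ n + 1`, so the primes omitting it are
  -- `P_∞` and the `P_m` with `m > n`; the finitely many `P_m` with `m < n` are added as closed
  -- points.
  have h : {hG.spcPoint n}ᶜ = {P : Spc (FinGenRep k U) | ¬ P.carrier (projRep k (G (n + 1)))} ∪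
      ⋃ m ∈ Set.Iio n, {hG.spcPoint m} := by
    ext P
    obtain ⟨t, rfl⟩ := hG.spcPoint_bijective.2 P
    simp only [Set.mem_compl_iff, Set.mem_singleton_iff, hG.spcPoint_bijective.1.eq_iff,
      Set.mem_union, Set.mem_ofPred_eq, Set.mem_iUnion, Set.mem_Iio, exists_prop]
    induction t using OnePoint.rec with
    | infty =>
      refine iff_of_true (OnePoint.infty_ne_coe n) (Or.inl fun h => ?_)
      obtain ⟨N, hN⟩ := (hG.primeInfty_iff _).1 h
      exact absurd (hG.groupPrime_projRep.1 (hN (N + n + 1) (by omega))) (by omega)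
    | coe m =>
      have : (hG.spcPoint m).carrier (projRep k (G (n + 1))) ↔ m < n + 1 := hG.groupPrime_projRep
      simp only [this, OnePoint.coe_eq_coe, exists_eq_right']
      omega
  rw [← isClosed_compl_iff, h]
  exact (Spc.isClosed_notMem _).union
    ((Set.finite_Iio n).isClosed_biUnion fun m _ => hG.isClosed_singleton_spcPoint m)

/-- Of two distinct points at least one is some `P_n`, and the clopen set `{P_n}` and its complement
separate them. -/
lemma t2Space_spc (hG : IsNStableEnumeration k G) : T2Space (Spc (FinGenRep k U)) := by
  have hsep : ∀ (n : ℕ) (P : Spc (FinGenRep k U)), hG.spcPoint n ≠ P →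
      SeparatedNhds {hG.spcPoint n} {P} := fun n P h =>
    ⟨{hG.spcPoint n}, {hG.spcPoint n}ᶜ, hG.isOpen_singleton_spcPoint n,
      (hG.isClosed_singleton_spcPoint n).isOpen_compl, subset_rfl,
      by simpa using h, disjoint_compl_right⟩
  refine ⟨fun P Q hPQ => ?_⟩
  obtain ⟨s, rfl⟩ := hG.spcPoint_bijective.2 P
  obtain ⟨t, rfl⟩ := hG.spcPoint_bijective.2 Q
  simp only [← Set.singleton_subset_iff]
  induction s using OnePoint.rec with
  | infty =>
    induction t using OnePoint.rec with
    | infty => exact absurd rfl hPQ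
    | coe n => exact (hsep n _ hPQ.symm).symm
  | coe n => exact hsep n _ hPQ

/-- The homeomorphism from the one-point compactification of `ℕ` to the spectrum. -/
def spcHomeomorph (hG : IsNStableEnumeration k G) : OnePoint ℕ ≃ₜ Spc (FinGenRep k U) :=
  have := hG.t2Space_spc
  Continuous.homeoOfEquivCompactToT2 (f := Equiv.ofBijective _ hG.spcPoint_bijective)
    hG.continuous_spcPoint

end IsNStableEnumeration


end

theorem theorem1p2 {k : Type u} [Field k] [CharZero k]
    (U : ObjectProperty FinGrpOut.{u}) [U.IsClosedUnderIsomorphisms] [IsWidelyClosed U]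
    [(finGen k U).ContainsUnit] [IsNoetherianFamily k U]
    (G : ℕ → U.FullSubcategory) (hG : IsNStableEnumeration k G) :
    (∀ P : ObjectProperty (FinGenRep k U),
      IsPrimeSerreIdeal P ↔ (∃ n : ℕ, P = groupPrime k (G n)) ∨ P = primeInfty k U) ∧
    ∃ e : OnePoint ℕ ≃ₜ Spc (FinGenRep k U),
      (∀ n : ℕ, (e (n : OnePoint ℕ)).carrier = groupPrime k (G n)) ∧
      (e OnePoint.infty).carrier = primeInfty k U :=
  ⟨hG.isPrimeSerreIdeal_iff, hG.spcHomeomorph, fun _ => rfl, rfl⟩
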